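/- **Setting.** Let $N$ be a finite set of agents; agent $i$ owns one item $h_i$. A type of $i$ is a pair $\theta_i=(\succ_i,r_i)$ of a strict linear preference $\succ_i$ on the items and a neighbour set $r_i\subseteq N$. A (reported) profile $\theta=(\theta_i)_{i\in N}$ defines the directed network $G(\theta)$ with an edge $\langle i,j\rangle$ iff $j\in r_i$ (reports need not be symmetric). Fix a set $N_0\subseteq N$ of initial agents; $Q(\theta)$ is the set of qualified agents, those reachable from $N_0$ in $G(\theta)$. A matching mechanism $\pi$ assigns to every $\theta$ a bijective allocation $i\mapsto\pi_i(\theta)$ of the items to the agents. An ordering $\mathcal O$ assigns to every $\theta$ a linear order of the agents in which agents at smaller distance from $N_0$ in $G(\theta)$ come first (unreachable agents last); ties are broken arbitrarily. **Stable-cc.** A set $S$ forms a complete component of $G(\theta)$ if it is non-empty and $\langle i,j\rangle$ is an edge for all distinct $i,j\in S$. A mechanism $\pi$ is stable under complete components (stable-cc) if for no profile $\theta$ there are a set $S\subseteq Q(\theta)$ forming a complete component of $G(\theta)$ and an allocation $\pi'$ with $\pi'_i\in\{h_k:k\in S\}$ and $\pi'_i\succeq_i\pi_i(\theta)$ for all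 $i\in S$, and $\pi'_j\succ_j\pi_j(\theta)$ for some $j\in S$. **Connected Trading Cycles (CTC).** Unqualified agents keep their items. At the start each qualified agent points to the owner of her favourite item among the items of qualified agents, and the settled set is $V=\emptyset$. While $V\neq Q(\theta)$, put $U=Q(\theta)\setminus V$ and do the following round. "$i$ switches" means that $i$ now points to the owner of her favourite item among the items of agents in $U$ that she likes strictly less than the item she pointed to. Paths are simple and directed, and the path from an agent to herself is the trivial one. 1. Follow the pointing from the first agent of $U$ in the order until a cycle $C=(c_1,\dots,c_m)$ closes, listed from the first of its agents that is reached. 2. Let $T\subseteq U$ be a set of least size that contains $C$, induces a strongly connected subgraph of $G(\theta)$, and contains the agent pointed to by each of its members. If no such set exists, the last agent on $C$ who has no path in $U$ to the agent she points to switches; if there is no such agent, the last agent on $C$ who has no path to the agent she points to using agents on $C$ only switches. The round ends. 3. Otherwise mark the edges of the subgraph $G_T$ induced on $T$. Each self-pointing $i\in T$ marks all her outgoing edges. Each $i\in T$ puts a shortest path in $G_T$ from $i$ to the agent she points to into a set $SP$. While $SP\neq\emptyset$: remove its first path (smallest length, ties by the order), say that of $i$; $i$ marks all its edges; if it bears a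 mark of another agent and $i$ has a path not used yet, her next shortest path enters $SP$. The last path taken from $SP$ for $i$ is called $i$'s path. Let $S$ be the set of $i\in T$ such that no path in $G_T$ from $i$ to the agent she points to has all edges marked by $i$ and by nobody else, and no outgoing edge of $i$ in $G_T$ is marked by anyone but $i$. 4. If $S=\emptyset$ and $C=T$: add $T$ to $V$; every agent of the new $U=Q(\theta)\setminus V$ who points to a member of $V$ switches, with respect to the new $U$. 5. If $S=\emptyset$ and $C\subsetneq T$: let $j$ be the first agent of $T\setminus C$ in the order, and let $W$ be the sequence of agents visited by following the pointing from the agent $j$ points to, until it repeats. The last agent of $W$ on $C$ whose path has an interior node in $T\setminus C$ switches; if there is none, the last agent of $W$ in $T\setminus C$ whose path has an interior node on $C$; if there is none either, the last agent on $C$ whose path has an interior node in $T\setminus C$. 6. If $S\setminus C\neq\emptyset$: the first agent of $S\setminus C$ in the order switches. 7. If $\emptyset\ne S\subseteq C$: the first agent $i\in S$ whose path contains, as a subpath, the path of some other, not self-pointing, agent of $T$ switches; if there is none, the first agent of $S$ switches. When $V=Q(\theta)$, every qualified agent receives the item of the agent she points to. Choices left open by these rules (among several minimum sets $T$, among paths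 of equal length of one agent) may be made in any way, for each profile. **Theorem.** For every finite $N$, every $N_0\subseteq N$ and every ordering $\mathcal O$, CTC is well defined (some matching mechanism is obtained by executing these rules at every profile), and CTC is stable-cc: every matching mechanism obtained by executing these rules, with whatever choices, is stable under complete components. -/

import Mathlib

namespace HousingNetwork

/-! ## Housing markets on social networks

Every agent owns exactly one item, so an item is identified with the agent who owns it:
`prefers a b` says that the item of `a` is strictly preferred to the item of `b`, and an
allocation is a permutation `π` of the agents, where `π i` is the owner of the item that
`i` receives. -/

/-- The (reported) type of an agent: a strict preference over the items and a set of
neighbours. -/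
structure AgentType (N : Type*) where
  prefers : N → N → Prop
  strictTotal : IsStrictTotalOrder N prefers
  nbrs : Set N

/-- A type profile. The reported neighbour sets need not be symmetric. -/
abbrev Profile (N : Type*) := N → AgentType N

/-- A matching mechanism assigns to every profile an allocation. -/
abbrev Mechanism (N : Type*) := Profile N → Equiv.Perm N

/-- Weak preference. -/
def AgentType.weakly {N : Type*} (t : AgentType N) (a b : N) : Prop :=
  a = b ∨ t.prefers a b

/-- `k` owns the favourite item of agent `i` among the items owned by members of `A`. -/
def IsFavorite {N : Type*} (θ : Profile N) (i : N) (A : Set N) (k : N) : Prop :=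
  k ∈ A ∧ ∀ k' ∈ A, k' ≠ k → (θ i).prefers k k'

/-- `k` owns the favourite item of agent `i` among the items owned by members of `A` that `i`
likes strictly less than the item of `j`. -/
def IsNext {N : Type*} (θ : Profile N) (i : N) (A : Set N) (j k : N) : Prop :=
  IsFavorite θ i {x | x ∈ A ∧ (θ i).prefers j x} k

/-! ### The reported network -/

/-- The directed edges of the reported network. -/
def Edge {N : Type*} (θ : Profile N) (i j : N) : Prop := j ∈ (θ i).nbrs

/-- `i` is the end of a walk of length `k` that starts in `N₀`. -/
def WalkFrom {N : Type*} (θ : Profile N) (N₀ : Set N) : ℕ → N → Prop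
  | 0, i => i ∈ N₀
  | k + 1, i => ∃ j, WalkFrom θ N₀ k j ∧ Edge θ j i

/-- The qualified agents: those who are reached from `N₀` by a chain of invitations. -/
def qualified {N : Type*} (N₀ : Set N) (θ : Profile N) : Set N :=
  {i | ∃ k, WalkFrom θ N₀ k i}

/-- The length of a shortest path from `N₀` to `i` (`⊤` if there is none). -/
noncomputable def dist {N : Type*} (N₀ : Set N) (θ : Profile N) (i : N) : ℕ∞ :=
  ⨅ (k : ℕ) (_ : WalkFrom θ N₀ k i), (k : ℕ∞)

/-- `O θ i` is the position of agent `i` in the ordering used at the profile `θ`. Agents are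
sorted by their distance from `N₀`, and ties are broken in an arbitrary way. -/
def IsOrdering {N : Type*} [Fintype N] (N₀ : Set N)
    (O : Profile N → (N ≃ Fin (Fintype.card N))) : Prop :=
  ∀ θ i j, dist N₀ θ i < dist N₀ θ j → O θ i < O θ j

/-- There is a directed path from `i` to `j` in the subgraph of the network induced on `A`. -/
def Connects {N : Type*} (θ : Profile N) (A : Set N) : N → N → Prop :=
  Relation.ReflTransGen (fun a b => a ∈ A ∧ b ∈ A ∧ Edge θ a b)

/-- `L` is a (simple, directed) path from `i` to `j` in the subgraph induced on `T`, given by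
the sequence of its nodes. The path from an agent to herself is `[i]`. -/
def IsPath {N : Type*} (θ : Profile N) (T : Set N) (i j : N) (L : List N) : Prop :=
  L.head? = some i ∧ L.getLast? = some j ∧ L.Nodup ∧ (∀ x ∈ L, x ∈ T) ∧ L.IsChain (Edge θ)

/-- The edge `⟨a, b⟩` lies on the path `L`. -/
def OnPath {N : Type*} (L : List N) (a b : N) : Prop := [a, b] <:+: L

/-- The path `L` passes (strictly between its two ends) some agent in `X`. -/
def Passes {N : Type*} (L : List N) (X : Set N) : Prop :=
  ∃ x ∈ L, x ∈ X ∧ L.head? ≠ some x ∧ L.getLast? ≠ some x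

/-- `i` is the member of `A` with the smallest order. -/
def IsFirst {N : Type*} {n : ℕ} (ord : N ≃ Fin n) (A : Set N) (i : N) : Prop :=
  i ∈ A ∧ ∀ j ∈ A, ord i ≤ ord j

/-- `i` is the last entry of the list `L` with the property `p`. -/
def IsLast {N : Type*} (L : List N) (p : N → Prop) (i : N) : Prop :=
  ∃ A B, L = A ++ i :: B ∧ p i ∧ ∀ x ∈ B, ¬ p x

/-! ### Path detection -/

/-- Follow the pointing `pt` from `p` until it closes up: the agents visited are, in this
order, `pre ++ C`, where `C` is the cycle that is reached. -/
def IsOrbit {N : Type*} (pt : N → N) (p : N) (pre C : List N) : Prop :=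
  (pre ++ C).head? = some p ∧ (pre ++ C).Nodup ∧
    (pre ++ C).IsChain (fun a b => pt a = b) ∧
    ∃ c d, C.head? = some c ∧ C.getLast? = some d ∧ pt d = c

/-- `T` is a connected set of agents, within the set `U` of agents still present, that
contains the cycle `C` and the pointing of each of its own members. -/
def IsComponentFor {N : Type*} (θ : Profile N) (U : Set N) (pt : N → N) (C : List N)
    (T : Set N) : Prop :=
  (∀ x ∈ C, x ∈ T) ∧ T ⊆ U ∧ (∀ i ∈ T, ∀ j ∈ T, Connects θ T i j) ∧ ∀ i ∈ T, pt i ∈ T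

/-- Such a set with the least possible number of agents. -/
def IsMinComponentFor {N : Type*} (θ : Profile N) (U : Set N) (pt : N → N) (C : List N)
    (T : Set N) : Prop :=
  IsComponentFor θ U pt C T ∧ ∀ T', IsComponentFor θ U pt C T' → T.ncard ≤ T'.ncard

/-- A state of the marking process: `active` are the agents whose path is currently in the
path set; `rem i` lists the paths of `i` not yet dismissed, the current one first;
`marks a b` are the agents who have marked the edge `⟨a, b⟩`. -/
structure MarkState (N : Type*) where
  active : Set N
  rem : N → List (List N)
  marks : N → N → Set N

/-- At the start each agent in `T` has all her paths to her pointing available, by ascending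
length (paths of equal length in an arbitrary order), the first one is in the path set, and
an agent who points to herself has marked all her outgoing edges. -/
def IsMarkInit {N : Type*} (θ : Profile N) (pt : N → N) (T : Set N) (s : MarkState N) : Prop :=
  s.active = T ∧
  (∀ i ∈ T, (s.rem i).Nodup ∧ (∀ L, L ∈ s.rem i ↔ IsPath θ T i (pt i) L) ∧
    (s.rem i).Pairwise (fun L L' => L.length ≤ L'.length)) ∧
  ∀ a b, s.marks a b = {m | m = a ∧ pt a = a ∧ a ∈ T ∧ b ∈ T ∧ Edge θ a b}

/-- One step of the marking process: remove the first path `L` (shortest, ties by order) from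
the path set, say that of `i`, and let `i` mark its edges. If `L` bears a mark of another agent
and `i` has a further path, her next path enters the path set. -/
def MarkStep {N : Type*} {n : ℕ} (ord : N ≃ Fin n) (s s' : MarkState N) : Prop :=
  ∃ i ∈ s.active, ∃ L rest, s.rem i = L :: rest ∧
    (∀ j ∈ s.active, ∀ L' rest', s.rem j = L' :: rest' →
      L.length < L'.length ∨ (L.length = L'.length ∧ ord i ≤ ord j)) ∧
    (∀ a b, s'.marks a b = {m | m ∈ s.marks a b ∨ (m = i ∧ OnPath L a b)}) ∧
    (((rest ≠ [] ∧ ∃ a b, OnPath L a b ∧ ∃ m ∈ s.marks a b, m ≠ i) ∧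
        s'.active = s.active ∧ s'.rem i = rest ∧ ∀ j, j ≠ i → s'.rem j = s.rem j) ∨
      (¬ (rest ≠ [] ∧ ∃ a b, OnPath L a b ∧ ∃ m ∈ s.marks a b, m ≠ i) ∧
        s'.active = s.active \ {i} ∧ s'.rem = s.rem))

/-- The result of the marking process on the subgraph induced on `T`: the marks on the edges
and, for each `i ∈ T`, the last path `path i` of hers that was taken from the path set. -/
def IsMarking {N : Type*} {n : ℕ} (θ : Profile N) (ord : N ≃ Fin n) (pt : N → N) (T : Set N)
    (marks : N → N → Set N) (path : N → List N) : Prop :=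
  ∃ s₀ s, IsMarkInit θ pt T s₀ ∧ Relation.ReflTransGen (MarkStep ord) s₀ s ∧
    s.active = ∅ ∧ s.marks = marks ∧ ∀ i ∈ T, ∃ rest, s.rem i = path i :: rest

/-- The agents `i ∈ T` such that no path from `i` to her pointing is exclusively marked by
`i`, and whose outgoing edges are marked by nobody but `i`. -/
def switchSet {N : Type*} (θ : Profile N) (pt : N → N) (T : Set N)
    (marks : N → N → Set N) : Set N :=
  {i | i ∈ T ∧ (¬ ∃ L, IsPath θ T i (pt i) L ∧ ∀ a b, OnPath L a b → marks a b = {i}) ∧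
    ∀ b ∈ T, Edge θ i b → ∀ m ∈ marks i b, m = i}

/-! ### Connected Trading Cycles -/

/-- A state of the mechanism: the settled agents and the current pointing. -/
structure State (N : Type*) where
  settled : Set N
  pt : N → N

/-- At the start nobody is settled and each qualified agent points to the owner of her favourite
item among those of the qualified agents. (An unqualified agent takes no part and is
left with her own item.) -/
def IsInit {N : Type*} (N₀ : Set N) (θ : Profile N) (s : State N) : Prop :=
  s.settled = ∅ ∧ (∀ i ∈ qualified N₀ θ, IsFavorite θ i (qualified N₀ θ) (s.pt i)) ∧
    ∀ i, i ∉ qualified N₀ θ → s.pt i = i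

/-- From `s` to `s'` agent `i`, and nobody else, switches to her next favourite item among those
of the agents in `U`. -/
def Switch {N : Type*} (θ : Profile N) (U : Set N) (i : N) (s s' : State N) : Prop :=
  s'.settled = s.settled ∧ IsNext θ i U (s.pt i) (s'.pt i) ∧ ∀ j, j ≠ i → s'.pt j = s.pt j

/-- The agent on `C` who switches when there is no component for `C`: the last one who is not
connected to her pointing; if there is none, the last one who is not connected to her pointing
by agents on `C` alone. -/
def NoComponentPick {N : Type*} (θ : Profile N) (U : Set N) (pt : N → N) (C : List N)
    (i : N) : Prop :=
  IsLast C (fun x => ¬ Connects θ U x (pt x)) i ∨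
    ((∀ x ∈ C, Connects θ U x (pt x)) ∧
      IsLast C (fun x => ¬ Connects θ {y | y ∈ C} x (pt x)) i)

/-- The agent who switches when the cycle `C` is a proper part of `T` and the switch set is
empty. Let `W` be the agents visited when one follows the pointing, starting from the pointing
of the agent `j ∈ T \ C` with the smallest order. The pick is the last agent of `W` on `C`
whose path passes an agent off `C`; if there is none, the last agent of `W` off `C` whose path
passes an agent on `C`; if there is none either, the last agent of `C` whose path passes an
agent off `C`. -/
def OffCyclePick {N : Type*} {n : ℕ} (ord : N ≃ Fin n) (pt : N → N) (C : List N) (T : Set N)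
    (path : N → List N) (i : N) : Prop :=
  ∃ j pre C', IsFirst ord (T \ {x | x ∈ C}) j ∧ IsOrbit pt (pt j) pre C' ∧
    (let W := pre ++ C'
     let P : N → Prop := fun x => x ∈ C ∧ Passes (path x) (T \ {y | y ∈ C})
     let R : N → Prop := fun x => x ∈ T ∧ x ∉ C ∧ Passes (path x) {y | y ∈ C}
     IsLast W P i ∨
       ((∀ x ∈ W, ¬ P x) ∧ IsLast W R i) ∨
       ((∀ x ∈ W, ¬ P x) ∧ (∀ x ∈ W, ¬ R x) ∧ IsLast C P i))

/-- The path of `i` covers the path, to her pointing, of another agent in `T` (one who does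
not point to herself). -/
def Covers {N : Type*} (pt : N → N) (T : Set N) (path : N → List N) (i : N) : Prop :=
  ∃ k ∈ T, k ≠ i ∧ pt k ≠ k ∧ path k <:+: path i

/-- The agent who switches when the switch set `S` is non-empty and consists of agents on the
cycle: the first one in `S` whose path covers another agent's path; if there is none, the
first one in `S`. -/
def OnCyclePick {N : Type*} {n : ℕ} (ord : N ≃ Fin n) (pt : N → N) (T S : Set N)
    (path : N → List N) (i : N) : Prop :=
  IsFirst ord {x | x ∈ S ∧ Covers pt T path x} i ∨
    ((∀ x ∈ S, ¬ Covers pt T path x) ∧ IsFirst ord S i)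

/-- One round of Connected Trading Cycles at the profile `θ`, where `Q` is the set of qualified
agents and `ord` the order of the agents. -/
inductive Step {N : Type*} {n : ℕ} (θ : Profile N) (Q : Set N) (ord : N ≃ Fin n) :
    State N → State N → Prop
  /-- no connected set contains the cycle and is closed under pointing -/
  | noComponent (s s' : State N) (p i : N) (pre C : List N)
      (start : IsFirst ord (Q \ s.settled) p) (cycle : IsOrbit s.pt p pre C)
      (none : ∀ T, ¬ IsComponentFor θ (Q \ s.settled) s.pt C T)
      (pick : NoComponentPick θ (Q \ s.settled) s.pt C i)
      (switch : Switch θ (Q \ s.settled) i s s') : Step θ Q ord s s'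
  /-- the cycle trades, and those who pointed to one of its members switch -/
  | trade (s s' : State N) (p : N) (pre C : List N) (T : Set N)
      (marks : N → N → Set N) (path : N → List N)
      (start : IsFirst ord (Q \ s.settled) p) (cycle : IsOrbit s.pt p pre C)
      (component : IsMinComponentFor θ (Q \ s.settled) s.pt C T)
      (marking : IsMarking θ ord s.pt T marks path)
      (empty : switchSet θ s.pt T marks = ∅) (eq : {x | x ∈ C} = T)
      (settle : s'.settled = s.settled ∪ T)
      (repoint : ∀ i ∈ Q \ s'.settled, s.pt i ∈ s'.settled →
        IsNext θ i (Q \ s'.settled) (s.pt i) (s'.pt i))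
      (keep : ∀ i, ¬ (i ∈ Q \ s'.settled ∧ s.pt i ∈ s'.settled) → s'.pt i = s.pt i) :
      Step θ Q ord s s'
  /-- the switch set is empty, but the cycle relies on agents outside it -/
  | offCycle (s s' : State N) (p i : N) (pre C : List N) (T : Set N)
      (marks : N → N → Set N) (path : N → List N)
      (start : IsFirst ord (Q \ s.settled) p) (cycle : IsOrbit s.pt p pre C)
      (component : IsMinComponentFor θ (Q \ s.settled) s.pt C T)
      (marking : IsMarking θ ord s.pt T marks path)
      (empty : switchSet θ s.pt T marks = ∅) (ne : {x | x ∈ C} ≠ T)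
      (pick : OffCyclePick ord s.pt C T path i)
      (switch : Switch θ (Q \ s.settled) i s s') : Step θ Q ord s s'
  /-- the switch set contains an agent outside the cycle -/
  | switchOff (s s' : State N) (p i : N) (pre C : List N) (T : Set N)
      (marks : N → N → Set N) (path : N → List N)
      (start : IsFirst ord (Q \ s.settled) p) (cycle : IsOrbit s.pt p pre C)
      (component : IsMinComponentFor θ (Q \ s.settled) s.pt C T)
      (marking : IsMarking θ ord s.pt T marks path)
      (pick : IsFirst ord (switchSet θ s.pt T marks \ {x | x ∈ C}) i)
      (switch : Switch θ (Q \ s.settled) i s s') : Step θ Q ord s s'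
  /-- the switch set is non-empty and consists of agents on the cycle -/
  | switchOn (s s' : State N) (p i : N) (pre C : List N) (T : Set N)
      (marks : N → N → Set N) (path : N → List N)
      (start : IsFirst ord (Q \ s.settled) p) (cycle : IsOrbit s.pt p pre C)
      (component : IsMinComponentFor θ (Q \ s.settled) s.pt C T)
      (marking : IsMarking θ ord s.pt T marks path)
      (nonempty : (switchSet θ s.pt T marks).Nonempty)
      (sub : switchSet θ s.pt T marks ⊆ {x | x ∈ C})
      (pick : OnCyclePick ord s.pt T (switchSet θ s.pt T marks) path i)
      (switch : Switch θ (Q \ s.settled) i s s') : Step θ Q ord s s'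

/-- `π` is Connected Trading Cycles with initial agents `N₀` and ordering `O`: at every profile
it returns the final pointing of an execution that has settled all qualified agents. (The rules
leave open which of several minimum components is taken, and which of several paths of equal
length of one agent comes first; every such choice is admitted.) -/
def IsCTC {N : Type*} [Fintype N] (N₀ : Set N) (O : Profile N → (N ≃ Fin (Fintype.card N)))
    (π : Mechanism N) : Prop :=
  ∀ θ, ∃ s₀ s, IsInit N₀ θ s₀ ∧
    Relation.ReflTransGen (Step θ (qualified N₀ θ) (O θ)) s₀ s ∧
    s.settled = qualified N₀ θ ∧ ∀ i, π θ i = s.pt i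

/-! ### Stability under complete components -/

/-- The agents in `S` form a complete component: any two of them are joined by edges in
both directions. -/
def IsCompleteComponent {N : Type*} (θ : Profile N) (S : Set N) : Prop :=
  S.Nonempty ∧ ∀ i ∈ S, ∀ j ∈ S, i ≠ j → Edge θ i j

/-- Stability under complete components: no set `S` of participants that forms a complete
component has a reallocation of its own items that makes none of its members worse off and
at least one better off. -/
def StableCC {N : Type*} (N₀ : Set N) (π : Mechanism N) : Prop :=
  ∀ θ, ¬ ∃ S ⊆ qualified N₀ θ, IsCompleteComponent θ S ∧
    ∃ π' : Equiv.Perm N, (∀ i ∈ S, π' i ∈ S) ∧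
      (∀ i ∈ S, (θ i).weakly (π' i) (π θ i)) ∧
      ∃ j ∈ S, (θ j).prefers (π' j) (π θ j)

end HousingNetwork

/-! Only one feature of the many switching rules matters for stability: an agent who switches alone
neither points to herself nor has an edge to the agent she points to (`Step.cases`). Hence no agent
gives up her own item or a neighbour's item while its owner is still present. This yields the core
of `Invariant`: an unsettled agent points to something at least as good as her own item and every
item of an unsettled neighbour. When her cycle trades, any own or neighbouring item she would prefer
has therefore been settled strictly earlier.

Let `t` record when agents are settled. It is constant along each trading cycle, so `t` agrees at an
agent and at the owner of the item she receives. In a blocking complete component every item on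
offer to a member belongs to herself or to a neighbour. So `t (π' i) ≤ t i`, strictly for whoever
gains. Since `π'` permutes the component, the two sums of `t` over it are equal, a contradiction.

The graph-theoretic work lies in the claim about switchers, and the crucial case is
`IsMarking.direct`: an agent with an edge to her pointing keeps that edge as her path, so she
neither passes an interior node nor enters the switch set.

For existence, each rule's choice is shown to be possible, `potential` strictly decreases in every
round, and the final pointing is injective. -/

namespace HousingNetwork

/-! ### First and last elements; chains of pointings. -/

section Lists

theorem mem_of_isChain_map_eq {N : Type*} {pt : N → N} {U : Set N} (hU : ∀ x ∈ U, pt x ∈ U) :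
    ∀ {L : List N}, L.IsChain (fun a b => pt a = b) → (∀ p, L.head? = some p → p ∈ U) →
      ∀ x ∈ L, x ∈ U
  | [], _, _, x, hx => by simp at hx
  | [a], _, h, x, hx => by
    simp at hx; subst hx; exact h x rfl
  | a :: b :: L, hc, h, x, hx => by
    rw [List.isChain_cons_cons] at hc
    have ha : a ∈ U := h a rfl
    rcases List.mem_cons.1 hx with rfl | hx
    · exact ha
    · refine mem_of_isChain_map_eq hU hc.2 ?_ x hx
      intro p hp
      simp at hp
      rw [← hp, ← hc.1]
      exact hU a ha

theorem exists_isLast {N : Type*} (p : N → Prop) :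
    ∀ {L : List N}, (∃ x ∈ L, p x) → ∃ i, IsLast L p i
  | [], h => by simp at h
  | a :: L, h => by
    by_cases hL : ∃ x ∈ L, p x
    · obtain ⟨i, A, B, rfl, hi⟩ := exists_isLast p hL
      exact ⟨i, a :: A, B, rfl, hi⟩
    · push Not at hL
      obtain ⟨x, hx, hp⟩ := h
      rcases List.mem_cons.1 hx with rfl | hx
      · exact ⟨x, [], L, rfl, hp, hL⟩
      · exact absurd hp (hL x hx)

theorem IsLast.mem {N : Type*} {L : List N} {p : N → Prop} {i : N} (h : IsLast L p i) :
    i ∈ L := by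
  obtain ⟨A, B, rfl, -⟩ := h
  simp

theorem IsLast.prop {N : Type*} {L : List N} {p : N → Prop} {i : N} (h : IsLast L p i) :
    p i := by
  obtain ⟨A, B, -, h, -⟩ := h
  exact h

theorem exists_isFirst {N : Type*} {n : ℕ} (ord : N ≃ Fin n) {A : Set N} (hA : A.Nonempty) :
    ∃ i, IsFirst ord A i := by
  have : Finite N := Finite.of_equiv _ ord.symm
  obtain ⟨i, hi, h⟩ := Set.exists_min_image A ord A.toFinite hA
  exact ⟨i, hi, h⟩

end Lists

/-! ### Cycles reached by following the pointing. -/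

section Orbits

variable {N : Type*} {pt : N → N} {p : N} {pre C : List N}

/-- Extend the chain by the pointing of its last agent until that pointing is already on it, then
split there. The induction is on the number `k` of agents not yet visited; at `k = 0` the list is
everybody, so the chain must close. -/
theorem exists_isOrbit_of_isChain [Fintype N] (pt : N → N) (p : N) (k : ℕ) :
    ∀ L : List N, L.length + k = Fintype.card N → L.Nodup →
      L.IsChain (fun a b => pt a = b) → L.head? = some p → ∃ pre C, IsOrbit pt p pre C := by
  classical
  induction k with
  | zero =>
    intro L hk hn hc hp
    have hne : L ≠ [] := by rintro rfl; simp at hp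
    have huniv : pt (L.getLast hne) ∈ L := by
      have h1 : L.toFinset = Finset.univ := by
        rw [← Finset.card_eq_iff_eq_univ, List.toFinset_card_of_nodup hn]; omega
      rw [← List.mem_toFinset, h1]; exact Finset.mem_univ _
    obtain ⟨A, B, hAB⟩ := List.append_of_mem huniv
    refine ⟨A, _ :: B, ?_, ?_, ?_, pt (L.getLast hne), L.getLast hne, rfl, ?_, rfl⟩
    · rw [← hAB, hp]
    · rw [← hAB]; exact hn
    · rw [← hAB]; exact hc
    · have : L.getLast? = some (L.getLast hne) := List.getLast?_eq_some_getLast hne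
      generalize L.getLast hne = d at *
      subst hAB
      simpa using this
  | succ k ih =>
    intro L hk hn hc hp
    have hne : L ≠ [] := by rintro rfl; simp at hp
    have hlast : L.getLast? = some (L.getLast hne) := List.getLast?_eq_some_getLast hne
    by_cases hmem : pt (L.getLast hne) ∈ L
    · obtain ⟨A, B, hAB⟩ := List.append_of_mem hmem
      refine ⟨A, _ :: B, ?_, ?_, ?_, pt (L.getLast hne), L.getLast hne, rfl, ?_, rfl⟩
      · rw [← hAB, hp]
      · rw [← hAB]; exact hn
      · rw [← hAB]; exact hc
      · generalize L.getLast hne = d at *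
        subst hAB
        simpa using hlast
    · refine ih (L ++ [pt (L.getLast hne)]) ?_ ?_ ?_ ?_
      · simp; omega
      · rw [List.nodup_append]
        refine ⟨hn, by simp, ?_⟩
        intro a ha b hb hab
        simp at hb
        subst hb; subst hab
        exact hmem ha
      · rw [List.isChain_append]
        refine ⟨hc, by simp, ?_⟩
        intro x hx y hy
        rw [hlast] at hx
        simp at hx hy
        rw [← hx, hy]
      · rw [List.head?_append, hp]; rfl

theorem exists_isOrbit [Fintype N] (pt : N → N) (p : N) : ∃ pre C, IsOrbit pt p pre C := by
  have : 0 < Fintype.card N := Fintype.card_pos_iff.2 ⟨p⟩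
  exact exists_isOrbit_of_isChain pt p (Fintype.card N - 1) [p] (by simp; omega) (by simp)
    (by simp) rfl

theorem IsOrbit.mem_of_closed (h : IsOrbit pt p pre C) {U : Set N} (hU : ∀ x ∈ U, pt x ∈ U)
    (hp : p ∈ U) : ∀ x ∈ pre ++ C, x ∈ U := by
  refine mem_of_isChain_map_eq hU h.2.2.1 fun q hq => ?_
  rw [h.1] at hq
  simp at hq
  exact hq ▸ hp

theorem IsOrbit.nonempty (h : IsOrbit pt p pre C) : ∃ c, c ∈ C := by
  obtain ⟨-, -, -, c, d, hc, -⟩ := h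
  exact ⟨c, List.mem_of_mem_head? hc⟩

theorem IsOrbit.isChain (h : IsOrbit pt p pre C) : C.IsChain (fun a b => pt a = b) :=
  (List.isChain_append.1 h.2.2.1).2.1

theorem IsOrbit.map_mem (h : IsOrbit pt p pre C) {x : N} (hx : x ∈ C) : pt x ∈ C := by
  have hch := h.isChain
  obtain ⟨-, -, -, c, d, hc, hd, hdc⟩ := h
  obtain ⟨A, B, rfl⟩ := List.append_of_mem hx
  cases B with
  | nil =>
    simp at hd
    subst hd
    rw [hdc]
    exact List.mem_of_mem_head? hc
  | cons b B =>
    have := (List.isChain_append.1 hch).2.1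
    rw [List.isChain_cons_cons] at this
    rw [this.1]
    simp

theorem IsOrbit.exists_preimage (h : IsOrbit pt p pre C) {y : N} (hy : y ∈ C) :
    ∃ x ∈ C, pt x = y := by
  have hch := h.isChain
  obtain ⟨-, -, -, c, d, hc, hd, hdc⟩ := h
  obtain ⟨A, B, rfl⟩ := List.append_of_mem hy
  rcases List.eq_nil_or_concat A with rfl | ⟨A, a, rfl⟩
  · simp at hc
    subst hc
    exact ⟨d, List.mem_of_getLast? hd, hdc⟩
  · refine ⟨a, by simp, ?_⟩
    have := (List.isChain_append.1 hch).2.2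
    exact this a (by simp) y (by simp)

/-- The pointing maps the finite set `C` onto itself, hence injectively. -/
theorem IsOrbit.injOn [Finite N] (h : IsOrbit pt p pre C) : Set.InjOn pt {x | x ∈ C} := by
  have hs : Set.SurjOn pt {x | x ∈ C} {x | x ∈ C} := fun y hy => h.exists_preimage hy
  have hm : Set.MapsTo pt {x | x ∈ C} {x | x ∈ C} := fun x hx => h.map_mem hx
  have := (Set.toFinite {x | x ∈ C}).injOn_of_encard_image_eq (f := pt)
    (by rw [(Set.image_subset_iff.2 hm).antisymm hs])
  exact this

/-- A relation that links each agent on a cycle to her pointing links any two of its agents. -/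
theorem IsOrbit.related (h : IsOrbit pt p pre C) {r : N → N → Prop}
    (hr : ∀ x ∈ C, Relation.ReflTransGen r x (pt x)) {i j : N} (hi : i ∈ C) (hj : j ∈ C) :
    Relation.ReflTransGen r i j := by
  have hch := h.isChain
  obtain ⟨-, -, -, c, d, hc, hd, hdc⟩ := h
  have hch' : C.IsChain (Relation.ReflTransGen r) :=
    hch.imp_of_mem_imp fun a b ha _ (hab : pt a = b) => hab ▸ hr a ha
  have hp : C.Pairwise (Relation.ReflTransGen r) := hch'.pairwise
  -- Travel from `i` to the end `d` of the list, over the closing link `d → c`, and from the head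
  -- `c` on to `j`.
  have hid : Relation.ReflTransGen r i d := by
    obtain ⟨D, rfl⟩ := List.getLast?_eq_some_iff.1 hd
    rcases List.mem_append.1 hi with hi | hi
    · exact (List.pairwise_append.1 hp).2.2 i hi d (by simp)
    · simp at hi; subst hi; exact .refl
  have hcj : Relation.ReflTransGen r c j := by
    obtain ⟨D, rfl⟩ := List.head?_eq_some_iff.1 hc
    rcases List.mem_cons.1 hj with rfl | hj
    · exact .refl
    · exact (List.pairwise_cons.1 hp).1 j hj
  have hdc' := hr d (List.mem_of_getLast? hd)
  rw [hdc] at hdc'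
  exact (hid.trans hdc').trans hcj

end Orbits

/-! ### Strict preferences and favourite items. -/

section Preferences

variable {N : Type*}

theorem AgentType.irrefl (t : AgentType N) (a : N) : ¬ t.prefers a a := by
  have := t.strictTotal
  exact _root_.irrefl a

theorem AgentType.trans (t : AgentType N) {a b c : N} (h : t.prefers a b) (h' : t.prefers b c) :
    t.prefers a c := by
  have := t.strictTotal
  exact _root_.trans h h'

theorem AgentType.total (t : AgentType N) (a b : N) :
    t.prefers a b ∨ a = b ∨ t.prefers b a := by
  have := t.strictTotal
  exact trichotomous_of t.prefers a b

theorem exists_isFavorite [Finite N] (θ : Profile N) (i : N) {A : Set N} (hA : A.Nonempty) :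
    ∃ k, IsFavorite θ i A k := by
  have := (θ i).strictTotal
  obtain ⟨k, hk, h⟩ := (Finite.wellFounded_of_trans_of_irrefl (θ i).prefers).has_min A hA
  refine ⟨k, hk, fun k' hk' hne => ?_⟩
  rcases (θ i).total k k' with h1 | h1 | h1
  · exact h1
  · exact absurd h1.symm hne
  · exact absurd h1 (h k' hk')

theorem IsFavorite.not_prefers {θ : Profile N} {i : N} {A : Set N} {k x : N}
    (h : IsFavorite θ i A k) (hx : x ∈ A) : ¬ (θ i).prefers x k := by
  intro hp
  by_cases hxk : x = k
  · exact (θ i).irrefl k (hxk ▸ hp)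
  · exact (θ i).irrefl k ((θ i).trans (h.2 x hx hxk) hp)

end Preferences

/-! ### Simple paths in induced subgraphs. -/

section Paths

variable {N : Type*} {θ : Profile N} {T : Set N}

theorem IsPath.eq_singleton {i : N} {L : List N} (h : IsPath θ T i i L) : L = [i] := by
  obtain ⟨h1, h2, h3, -⟩ := h
  obtain ⟨D, rfl⟩ := List.head?_eq_some_iff.1 h1
  rcases List.eq_nil_or_concat D with rfl | ⟨D, a, rfl⟩
  · rfl
  · rw [List.concat_eq_append, ← List.cons_append, List.getLast?_concat] at h2
    cases h2
    simp at h3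

theorem IsPath.eq_pair {i j : N} {L : List N} (h : IsPath θ T i j L) (hij : i ≠ j)
    (hL : L.length ≤ 2) : L = [i, j] := by
  obtain ⟨h1, h2, -⟩ := h
  match L, hL with
  | [], _ => simp at h1
  | [a], _ => simp at h1 h2; exact absurd (h1.symm.trans h2) hij
  | [a, b], _ => simp at h1 h2; rw [h1, h2]

theorem isPath_pair {i j : N} (hi : i ∈ T) (hj : j ∈ T) (hij : i ≠ j) (he : Edge θ i j) :
    IsPath θ T i j [i, j] :=
  ⟨rfl, rfl, by simpa using hij, by simp [hi, hj], by simpa using he⟩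

theorem onPath_pair {i j a b : N} : OnPath [i, j] a b ↔ a = i ∧ b = j := by
  constructor
  · intro h
    have := h.eq_of_length rfl
    simpa using this
  · rintro ⟨rfl, rfl⟩
    exact List.infix_rfl

theorem not_onPath_singleton {i a b : N} : ¬ OnPath [i] a b := fun h => by
  have := h.length_le
  simp at this

theorem not_passes_singleton {i : N} {X : Set N} : ¬ Passes [i] X := by
  rintro ⟨x, hx, -, h, -⟩
  simp at hx h
  exact h hx.symm

theorem not_passes_pair {i j : N} {X : Set N} : ¬ Passes [i, j] X := by
  rintro ⟨x, hx, -, h, h'⟩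
  simp at hx h h'
  rcases hx with rfl | rfl
  · exact h rfl
  · exact h' rfl

/-- Prepend the edges of a walk one at a time; when the new node already lies on the path, cut off
everything before it. -/
theorem Connects.exists_isPath {i j : N} (hj : j ∈ T) (h : Connects θ T i j) :
    ∃ L, IsPath θ T i j L := by
  induction h using Relation.ReflTransGen.head_induction_on with
  | refl => exact ⟨[j], rfl, rfl, by simp, by simp [hj], by simp⟩
  | head hab hbj ih =>
    rename_i a b
    obtain ⟨L, h1, h2, h3, h4, h5⟩ := ih
    by_cases ha : a ∈ L
    · obtain ⟨A, B, rfl⟩ := List.append_of_mem ha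
      refine ⟨a :: B, rfl, ?_, (List.nodup_append.1 h3).2.1, ?_, (List.isChain_append.1 h5).2.1⟩
      · simpa using h2
      · intro x hx; exact h4 x (by simp only [List.mem_append]; exact .inr hx)
    · obtain ⟨D, rfl⟩ := List.head?_eq_some_iff.1 h1
      refine ⟨a :: b :: D, rfl, ?_, List.nodup_cons.2 ⟨ha, h3⟩, ?_, ?_⟩
      · simpa using h2
      · intro x hx
        rcases List.mem_cons.1 hx with rfl | hx
        · exact hab.1
        · exact h4 x hx
      · exact List.isChain_cons_cons.2 ⟨hab.2.2, h5⟩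

theorem IsPath.connects {i j : N} {L : List N} {A : Set N} (h : IsPath θ T i j L)
    (hA : ∀ x ∈ L, x ∈ A) : Connects θ A i j := by
  obtain ⟨h1, h2, -, -, h5⟩ := h
  induction L generalizing i with
  | nil => simp at h1
  | cons a L ih =>
    simp at h1
    subst h1
    cases L with
    | nil => simp at h2; subst h2; exact .refl
    | cons b L =>
      rw [List.isChain_cons_cons] at h5
      refine .head ⟨hA a (by simp), hA b (by simp), h5.1⟩ (ih ?_ rfl ?_ h5.2)
      · intro x hx; exact hA x (List.mem_cons_of_mem _ hx)
      · simpa using h2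

/-- Simple paths are lists without repetition over a finite type, so there are finitely many and
they can be sorted by length. -/
theorem exists_path_list [Finite N] (θ : Profile N) (T : Set N) (i j : N) :
    ∃ Ls : List (List N), Ls.Nodup ∧ (∀ L, L ∈ Ls ↔ IsPath θ T i j L) ∧
      Ls.Pairwise (fun L L' => L.length ≤ L'.length) := by
  classical
  have := Fintype.ofFinite N
  have hfin : {L | IsPath θ T i j L}.Finite :=
    (Set.finite_coe_iff.1 (inferInstanceAs (Finite {L : List N // L.Nodup}))).subset fun L hL => hL.2.2.1
  let r : List N → List N → Prop := fun L L' => L.length ≤ L'.length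
  have h1 : Std.Total r := ⟨fun a b => Nat.le_total _ _⟩
  have h2 : IsTrans (List N) r := ⟨fun a b c => Nat.le_trans⟩
  refine ⟨hfin.toFinset.toList.insertionSort r, ?_, ?_, List.pairwise_insertionSort r _⟩
  · exact (List.perm_insertionSort r _).nodup_iff.2 (Finset.nodup_toList _)
  · intro L
    rw [List.mem_insertionSort]
    simp

end Paths

/-! ### The marking process. -/

section Marking

variable {N : Type*} {θ : Profile N} {T : Set N} {n : ℕ} {ord : N ≃ Fin n} {pt : N → N}

/-- The process terminates because each step either dismisses a path or deactivates an agent, which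
lowers the number of remaining paths plus the number of active agents. No list of paths ever becomes
empty: the last path is never dismissed. -/
theorem exists_isMarking [Fintype N] (ord : N ≃ Fin n) (hpt : ∀ i ∈ T, pt i ∈ T)
    (hc : ∀ i ∈ T, ∀ j ∈ T, Connects θ T i j) :
    ∃ marks path, IsMarking θ ord pt T marks path := by
  classical
  have main : ∀ m : ℕ, ∀ s : MarkState N, ∑ i, (s.rem i).length + s.active.ncard = m →
      s.active ⊆ T → (∀ i ∈ T, s.rem i ≠ []) →
      ∃ s', Relation.ReflTransGen (MarkStep ord) s s' ∧ s'.active = ∅ ∧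
        ∀ i ∈ T, s'.rem i ≠ [] := by
    intro m
    induction m using Nat.strong_induction_on with
    | _ m ih =>
    intro s hm hsub hne
    rcases s.active.eq_empty_or_nonempty with hE | hE
    · exact ⟨s, .refl, hE, hne⟩
    -- The lexicographic minimum encodes "shortest, ties by order"; the default `0` never occurs, as
    -- active agents have paths left.
    obtain ⟨i, hi, hmin⟩ := Set.exists_min_image s.active
      (fun i => toLex ((s.rem i).head?.elim 0 List.length, ord i)) (Set.toFinite _) hE
    obtain ⟨L, rest, hL⟩ := List.exists_cons_of_ne_nil (hne i (hsub hi))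
    have hmin' : ∀ j ∈ s.active, ∀ L' rest', s.rem j = L' :: rest' →
        L.length < L'.length ∨ (L.length = L'.length ∧ ord i ≤ ord j) := by
      intro j hj L' rest' hL'
      have := hmin j hj
      rw [Prod.Lex.toLex_le_toLex] at this
      simpa [hL, hL'] using this
    by_cases hcond : rest ≠ [] ∧ ∃ a b, OnPath L a b ∧ ∃ m ∈ s.marks a b, m ≠ i
    · let s' : MarkState N := ⟨s.active, Function.update s.rem i rest,
        fun a b => {m | m ∈ s.marks a b ∨ (m = i ∧ OnPath L a b)}⟩
      have hstep : MarkStep ord s s' :=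
        ⟨i, hi, L, rest, hL, hmin', fun _ _ => rfl, .inl ⟨hcond, rfl, by simp [s'],
          fun j hj => by simp [s', hj]⟩⟩
      have hlt : ∑ j, (s'.rem j).length < ∑ j, (s.rem j).length := by
        refine Finset.sum_lt_sum (fun j _ => ?_) ⟨i, Finset.mem_univ _, by simp [s', hL]⟩
        by_cases hj : j = i
        · subst hj; simp [s', hL]
        · simp [s', hj]
      obtain ⟨s'', h1, h2⟩ := ih _ (by rw [← hm]; exact Nat.add_lt_add_right hlt _) s' rfl hsub
        (fun j hj => by
          by_cases hji : j = i
          · subst hji; simpa [s'] using hcond.1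
          · simpa [s', hji] using hne j hj)
      exact ⟨s'', .head hstep h1, h2⟩
    · let s' : MarkState N := ⟨s.active \ {i}, s.rem,
        fun a b => {m | m ∈ s.marks a b ∨ (m = i ∧ OnPath L a b)}⟩
      have hstep : MarkStep ord s s' :=
        ⟨i, hi, L, rest, hL, hmin', fun _ _ => rfl, .inr ⟨hcond, rfl, rfl⟩⟩
      have hlt : s'.active.ncard < s.active.ncard :=
        Set.ncard_sdiff_singleton_lt_of_mem hi (Set.toFinite _)
      obtain ⟨s'', h1, h2⟩ := ih _ (by rw [← hm]; exact Nat.add_lt_add_left hlt _) s' rfl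
        (Set.sdiff_subset.trans hsub) hne
      exact ⟨s'', .head hstep h1, h2⟩
  choose Ls h1 h2 h3 using fun i => exists_path_list θ T i (pt i)
  let s₀ : MarkState N := ⟨T, Ls, fun a b => {m | m = a ∧ pt a = a ∧ a ∈ T ∧ b ∈ T ∧ Edge θ a b}⟩
  obtain ⟨s, hs, hact, hne⟩ := main _ s₀ rfl subset_rfl (fun i hi h => by
    obtain ⟨L, hL⟩ := (hc i hi _ (hpt i hi)).exists_isPath (hpt i hi)
    have : L ∈ s₀.rem i := (h2 i L).2 hL
    rw [h] at this
    simp at this)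
  refine ⟨s.marks, fun i => (s.rem i).headI, s₀, s,
    ⟨rfl, fun i _ => ⟨h1 i, h2 i, h3 i⟩, fun _ _ => rfl⟩, hs, hact, rfl, fun i hi => ?_⟩
  obtain ⟨L, rest, hL⟩ := List.exists_cons_of_ne_nil (hne i hi)
  exact ⟨rest, by simp [hL]⟩

theorem IsMarkInit.head_isPath_of_reach {s₀ s : MarkState N} (h₀ : IsMarkInit θ pt T s₀)
    (h : Relation.ReflTransGen (MarkStep ord) s₀ s) :
    s.active ⊆ T ∧ ∀ i ∈ T, ∀ L ∈ s.rem i, IsPath θ T i (pt i) L := by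
  induction h with
  | refl => exact ⟨h₀.1.le, fun i hi L hL => ((h₀.2.1 i hi).2.1 L).1 hL⟩
  | tail _ hstep ih =>
    obtain ⟨i, hi, L, rest, hrem, -, -, h | h⟩ := hstep
    · obtain ⟨-, hact, hri, hrj⟩ := h
      refine ⟨hact ▸ ih.1, fun j hj L' hL' => ih.2 j hj L' ?_⟩
      by_cases hji : j = i
      · subst hji
        rw [hri] at hL'
        rw [hrem]
        exact List.mem_cons_of_mem _ hL'
      · rwa [hrj j hji] at hL'
    · obtain ⟨-, hact, hr⟩ := h
      exact ⟨hact ▸ Set.sdiff_subset.trans ih.1, hr ▸ ih.2⟩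

theorem IsMarking.isPath {marks : N → N → Set N} {path : N → List N}
    (h : IsMarking θ ord pt T marks path) {i : N} (hi : i ∈ T) :
    IsPath θ T i (pt i) (path i) := by
  obtain ⟨s₀, s, h₀, hs, -, -, hp⟩ := h
  obtain ⟨rest, hrest⟩ := hp i hi
  exact (h₀.head_isPath_of_reach hs).2 i hi _ (by simp [hrest])

/-- An agent who invites the agent she points to keeps the direct path and marks it. -/
theorem IsMarking.direct {marks : N → N → Set N} {path : N → List N}
    (h : IsMarking θ ord pt T marks path) {j : N} (hj : j ∈ T) (hk : pt j ∈ T) (hne : j ≠ pt j)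
    (he : Edge θ j (pt j)) : path j = [j, pt j] ∧ j ∈ marks j (pt j) := by
  obtain ⟨s₀, s, h₀, hs, hact, rfl, hp⟩ := h
  -- Invariant of the process: the direct path stays in front, and its edge is unmarked until `j`
  -- takes it. When she does, no foreign mark can force her on to another path.
  have key : (∃ rest, s.rem j = [j, pt j] :: rest) ∧
      ((j ∈ s.active ∧ s.marks j (pt j) = ∅) ∨ (j ∉ s.active ∧ j ∈ s.marks j (pt j))) := by
    clear hact hp
    induction hs with
    | refl =>
      obtain ⟨-, hmem, hsort⟩ := h₀.2.1 j hj
      -- The list is sorted and contains a path of length two, so its head has at most two nodes and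
      -- must be the direct path.
      have hpair := (hmem _).2 (isPath_pair hj hk hne he)
      refine ⟨?_, .inl ⟨h₀.1 ▸ hj, ?_⟩⟩
      · cases hr : s₀.rem j with
        | nil => rw [hr] at hpair; simp at hpair
        | cons L rest =>
          rw [hr] at hpair hsort hmem
          refine ⟨rest, ?_⟩
          rw [IsPath.eq_pair ((hmem L).1 (by simp)) hne ?_]
          rcases List.mem_cons.1 hpair with h | h
          · rw [← h]; simp
          · exact (List.pairwise_cons.1 hsort).1 _ h
      -- Initial marks sit on outgoing edges of self-pointing agents only, and `j` is not one of
      -- them.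
      · rw [h₀.2.2]
        ext m
        simp [hne.symm]
    | tail hreach hstep ih =>
      rename_i s s'
      have hP := h₀.head_isPath_of_reach hreach
      obtain ⟨⟨restj, hrj⟩, hcases⟩ := ih
      obtain ⟨i, hi, L, rest, hrem, hmin, hmarks, hnext⟩ := hstep
      by_cases hij : i = j
      · subst hij
        rw [hrj] at hrem
        obtain ⟨rfl, rfl⟩ := List.cons.inj hrem
        rcases hcases with ⟨-, hempty⟩ | ⟨hna, -⟩
        swap
        · exact absurd hi hna
        rcases hnext with ⟨⟨-, a, b, hab, m, hm, -⟩, -⟩ | ⟨-, hact', hrem'⟩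
        · obtain ⟨rfl, rfl⟩ := onPath_pair.1 hab
          rw [hempty] at hm
          exact absurd hm (Set.notMem_empty m)
        · refine ⟨⟨_, hrem' ▸ hrj⟩, .inr ⟨by simp [hact'], ?_⟩⟩
          rw [hmarks]
          exact .inr ⟨rfl, onPath_pair.2 ⟨rfl, rfl⟩⟩
      · have hrj' : s'.rem j = s.rem j := by
          rcases hnext with ⟨-, -, -, h⟩ | ⟨-, -, h⟩
          · exact h j (Ne.symm hij)
          · rw [h]
        have haj : j ∈ s'.active ↔ j ∈ s.active := by
          rcases hnext with ⟨-, h, -⟩ | ⟨-, h, -⟩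
          · rw [h]
          · simp [h, Ne.symm hij]
        refine ⟨⟨restj, hrj' ▸ hrj⟩, ?_⟩
        rcases hcases with ⟨hja, hempty⟩ | ⟨hna, hm⟩
        · refine .inl ⟨haj.2 hja, ?_⟩
          rw [hmarks, hempty]
          refine Set.eq_empty_iff_forall_notMem.2 ?_
          rintro m (hm | ⟨-, hon⟩)
          · exact hm
          -- While `j` waits with a path of two nodes, only paths of at most two nodes are taken.
          -- One that contains the edge from `j` to `pt j` would start at `j`, not at `i`.
          · have hlen : L.length ≤ 2 := by
              rcases hmin j hja _ _ hrj with h | h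
              · simp at h; omega
              · simp at h; omega
            have hL := hP.2 i (hP.1 hi) L (by simp [hrem])
            have h2 : 2 ≤ L.length := by simpa using hon.length_le
            have hLe := hon.eq_of_length (by simp; omega)
            have := hL.1
            rw [← hLe] at this
            simp at this
            exact hij this.symm
        · refine .inr ⟨fun h => hna (haj.1 h), ?_⟩
          rw [hmarks]
          exact .inl hm
  obtain ⟨⟨rest, hr⟩, hc⟩ := key
  obtain ⟨rest', hr'⟩ := hp j hj
  refine ⟨?_, ?_⟩
  · rw [hr] at hr'
    exact (List.cons.inj hr').1.symm
  · rcases hc with ⟨h, -⟩ | ⟨-, h⟩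
    · rw [hact] at h; exact absurd h (Set.notMem_empty j)
    · exact h

/-- A path with an interior node has at least three nodes, whereas a self-pointing agent has the
trivial path and an agent with a direct edge keeps that edge. -/
theorem IsMarking.of_passes {marks : N → N → Set N} {path : N → List N}
    (h : IsMarking θ ord pt T marks path) (hpt : ∀ i ∈ T, pt i ∈ T) {i : N} (hi : i ∈ T)
    {X : Set N} (hX : Passes (path i) X) : pt i ≠ i ∧ ¬ Edge θ i (pt i) := by
  have hne : pt i ≠ i := by
    intro heq
    have hp := h.isPath hi
    rw [heq] at hp
    rw [hp.eq_singleton] at hX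
    exact not_passes_singleton hX
  refine ⟨hne, fun he => ?_⟩
  rw [(h.direct hi (hpt i hi) hne.symm he).1] at hX
  exact not_passes_pair hX

/-- For a self-pointing agent the trivial path is vacuously exclusive. With a direct edge, `i` has
marked that edge, and the condition on outgoing edges bars all other marks, so the direct path would
be exclusive. -/
theorem IsMarking.of_mem_switchSet {marks : N → N → Set N} {path : N → List N}
    (h : IsMarking θ ord pt T marks path) (hpt : ∀ i ∈ T, pt i ∈ T) {i : N}
    (hi : i ∈ switchSet θ pt T marks) : pt i ≠ i ∧ ¬ Edge θ i (pt i) := by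
  obtain ⟨hiT, hno, hout⟩ := hi
  have hne : pt i ≠ i := fun heq =>
    hno ⟨[i], by rw [heq]; exact ⟨rfl, rfl, by simp, by simp [hiT], by simp⟩,
      fun a b hab => absurd hab not_onPath_singleton⟩
  refine ⟨hne, fun he => hno ⟨[i, pt i], isPath_pair hiT (hpt i hiT) hne.symm he, ?_⟩⟩
  intro a b hab
  obtain ⟨rfl, rfl⟩ := onPath_pair.1 hab
  refine Set.Subset.antisymm (fun m hm => hout _ (hpt _ hiT) he m hm) ?_
  rintro m rfl
  exact (h.direct hiT (hpt _ hiT) hne.symm he).2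

end Marking

/-! ### The invariant and the rounds of the mechanism. -/

section Rounds

variable {N : Type*} {n : ℕ} {θ : Profile N} {Q : Set N} {ord : N ≃ Fin n}

/-- The properties of a state that every round preserves. The function `t` in the last one is
the round at which an agent has been settled. -/
structure Invariant (θ : Profile N) (Q : Set N) (s : State N) : Prop where
  sub : s.settled ⊆ Q
  closed : ∀ i ∈ Q \ s.settled, s.pt i ∈ Q \ s.settled
  rational : ∀ i ∈ Q \ s.settled, ¬ (θ i).prefers i (s.pt i)
  nbrs : ∀ i ∈ Q \ s.settled, ∀ k ∈ Q \ s.settled, Edge θ i k → ¬ (θ i).prefers k (s.pt i)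
  mapsTo : ∀ i ∈ s.settled, s.pt i ∈ s.settled
  injOn : Set.InjOn s.pt s.settled
  outside : ∀ i ∉ Q, s.pt i = i
  times : ∃ t : N → ℕ, ∀ i ∈ s.settled, t (s.pt i) = t i ∧
    ∀ k ∈ Q, (Edge θ i k ∨ k = i) → (θ i).prefers k (s.pt i) → k ∈ s.settled ∧ t k < t i

theorem IsInit.invariant {N₀ : Set N} {s : State N} (h : IsInit N₀ θ s) :
    Invariant θ (qualified N₀ θ) s := by
  obtain ⟨hs, hfav, hout⟩ := h
  constructor
  · simp [hs]
  · intro i hi; rw [hs] at hi ⊢; exact ⟨(hfav i hi.1).1, by simp⟩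
  · intro i hi; exact (hfav i hi.1).not_prefers hi.1
  · intro i hi k hk _; exact (hfav i hi.1).not_prefers hk.1
  · simp [hs]
  · simp [hs]
  · exact hout
  · exact ⟨fun _ => 0, by simp [hs]⟩

/-- The cycle `T` trades, and those who pointed to one of its members switch. -/
structure Trade (θ : Profile N) (Q T : Set N) (s s' : State N) : Prop where
  settle : s'.settled = s.settled ∪ T
  repoint : ∀ i ∈ Q \ s'.settled, s.pt i ∈ s'.settled →
    IsNext θ i (Q \ s'.settled) (s.pt i) (s'.pt i)
  keep : ∀ i, ¬ (i ∈ Q \ s'.settled ∧ s.pt i ∈ s'.settled) → s'.pt i = s.pt i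

/-- A trivial path or a single edge would already connect `i` to her pointing, both in `U` and on
`C`. -/
theorem NoComponentPick.spec {U : Set N} {pt : N → N} {p i : N} {pre C : List N}
    (horb : IsOrbit pt p pre C) (hU : ∀ x ∈ U, pt x ∈ U) (hp : p ∈ U)
    (h : NoComponentPick θ U pt C i) : i ∈ U ∧ pt i ≠ i ∧ ¬ Edge θ i (pt i) := by
  have hCU : ∀ x ∈ C, x ∈ U := fun x hx =>
    horb.mem_of_closed hU hp x (List.mem_append.2 (.inr hx))
  have key : i ∈ C ∧ (¬ Connects θ U i (pt i) ∨ ¬ Connects θ {y | y ∈ C} i (pt i)) := by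
    rcases h with h | ⟨-, h⟩
    · exact ⟨h.mem, .inl h.prop⟩
    · exact ⟨h.mem, .inr h.prop⟩
  obtain ⟨hi, hcon⟩ := key
  have hU' := hCU i hi
  refine ⟨hU', fun heq => ?_, fun he => ?_⟩
  · rw [heq] at hcon
    rcases hcon with h | h <;> exact h .refl
  · rcases hcon with h | h
    · exact h (.single ⟨hU', hU i hU', he⟩)
    · exact h (.single ⟨hi, horb.map_mem hi, he⟩)

/-- If every agent on `C` were connected to her pointing within `C`, then `C` itself would be a
component. -/
theorem exists_noComponentPick {U : Set N} {pt : N → N} {p : N} {pre C : List N}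
    (horb : IsOrbit pt p pre C) (hU : ∀ x ∈ U, pt x ∈ U) (hp : p ∈ U)
    (hnone : ∀ T, ¬ IsComponentFor θ U pt C T) : ∃ i, NoComponentPick θ U pt C i := by
  by_cases h1 : ∃ x ∈ C, ¬ Connects θ U x (pt x)
  · obtain ⟨i, hi⟩ := exists_isLast _ h1
    exact ⟨i, .inl hi⟩
  push Not at h1
  by_cases h2 : ∃ x ∈ C, ¬ Connects θ {y | y ∈ C} x (pt x)
  · obtain ⟨i, hi⟩ := exists_isLast _ h2
    exact ⟨i, .inr ⟨h1, hi⟩⟩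
  push Not at h2
  refine absurd ⟨fun x hx => hx, ?_, ?_, ?_⟩ (hnone {x | x ∈ C})
  · exact fun x hx => horb.mem_of_closed hU hp x (List.mem_append.2 (.inr hx))
  · exact fun i hi j hj => horb.related h2 hi hj
  · exact fun i hi => horb.map_mem hi

/-- The third fallback always applies: if no path from `C` left `C`, then `C` would be a component
smaller than the minimum one `T`. -/
theorem exists_offCyclePick [Fintype N] {U T : Set N} {pt : N → N} {p : N} {pre C : List N}
    {marks : N → N → Set N} {path : N → List N} (horb : IsOrbit pt p pre C)
    (hT : IsMinComponentFor θ U pt C T) (hne : {x | x ∈ C} ≠ T)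
    (hm : IsMarking θ ord pt T marks path) : ∃ i, OffCyclePick ord pt C T path i := by
  have hsub : {x | x ∈ C} ⊆ T := hT.1.1
  have hdiff : (T \ {x | x ∈ C}).Nonempty :=
    Set.sdiff_nonempty.2 fun h => hne (hsub.antisymm h)
  obtain ⟨j, hj⟩ := exists_isFirst ord hdiff
  obtain ⟨pre', C', horb'⟩ := exists_isOrbit pt (pt j)
  by_cases hP : ∃ x ∈ pre' ++ C', x ∈ C ∧ Passes (path x) (T \ {y | y ∈ C})
  · obtain ⟨i, hi⟩ := exists_isLast _ hP
    exact ⟨i, j, pre', C', hj, horb', .inl hi⟩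
  have hP' : ∀ x ∈ pre' ++ C', ¬ (x ∈ C ∧ Passes (path x) (T \ {y | y ∈ C})) :=
    fun x hx h => hP ⟨x, hx, h⟩
  by_cases hR : ∃ x ∈ pre' ++ C', x ∈ T ∧ x ∉ C ∧ Passes (path x) {y | y ∈ C}
  · obtain ⟨i, hi⟩ := exists_isLast _ hR
    exact ⟨i, j, pre', C', hj, horb', .inr (.inl ⟨hP', hi⟩)⟩
  have hR' : ∀ x ∈ pre' ++ C', ¬ (x ∈ T ∧ x ∉ C ∧ Passes (path x) {y | y ∈ C}) :=
    fun x hx h => hR ⟨x, hx, h⟩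
  by_cases hC : ∃ x ∈ C, x ∈ C ∧ Passes (path x) (T \ {y | y ∈ C})
  · obtain ⟨i, hi⟩ := exists_isLast _ hC
    exact ⟨i, j, pre', C', hj, horb', .inr (.inr ⟨hP', hR', hi⟩)⟩
  exfalso
  have hcon : ∀ x ∈ C, Connects θ {y | y ∈ C} x (pt x) := by
    intro x hx
    have hpath := hm.isPath (hT.1.1 x hx)
    refine hpath.connects fun y hy => ?_
    by_contra hyC
    refine hC ⟨x, hx, hx, y, hy, ⟨hpath.2.2.2.1 y hy, hyC⟩, ?_, ?_⟩
    · rw [hpath.1]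
      rintro ⟨⟩
      exact hyC hx
    · rw [hpath.2.1]
      intro heq
      cases heq
      exact hyC (horb.map_mem hx)
  have hcomp : IsComponentFor θ U pt C {x | x ∈ C} :=
    ⟨fun x hx => hx, hsub.trans hT.1.2.1, fun i hi j hj => horb.related hcon hi hj,
      fun i hi => horb.map_mem hi⟩
  exact hne (Set.eq_of_subset_of_ncard_le hsub (hT.2 _ hcomp) (Set.toFinite _))

theorem OffCyclePick.spec {pt : N → N} {C : List N} {U T : Set N} {marks : N → N → Set N}
    {path : N → List N} {i : N} (hT : IsComponentFor θ U pt C T)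
    (hm : IsMarking θ ord pt T marks path) (h : OffCyclePick ord pt C T path i) :
    i ∈ U ∧ pt i ≠ i ∧ ¬ Edge θ i (pt i) := by
  obtain ⟨j, pre, C', -, -, h⟩ := h
  have key : i ∈ T ∧ ∃ X, Passes (path i) X := by
    rcases h with h | ⟨-, h⟩ | ⟨-, -, h⟩
    · exact ⟨hT.1 i h.prop.1, _, h.prop.2⟩
    · exact ⟨h.prop.1, _, h.prop.2.2⟩
    · exact ⟨hT.1 i h.prop.1, _, h.prop.2⟩
  obtain ⟨hi, X, hX⟩ := key
  exact ⟨hT.2.1 hi, hm.of_passes hT.2.2.2 hi hX⟩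

theorem OnCyclePick.mem {pt : N → N} {T S : Set N} {path : N → List N} {i : N}
    (h : OnCyclePick ord pt T S path i) : i ∈ S := by
  rcases h with h | ⟨-, h⟩
  · exact h.1.1
  · exact h.1

/-- Either a single agent switches, who does not invite the agent she points to, or a cycle
trades. -/
theorem Step.cases {s s' : State N} (hinv : Invariant θ Q s) (h : Step θ Q ord s s') :
    (∃ i ∈ Q \ s.settled, s.pt i ≠ i ∧ ¬ Edge θ i (s.pt i) ∧
        Switch θ (Q \ s.settled) i s s') ∨
      ∃ p pre C, p ∈ Q \ s.settled ∧ IsOrbit s.pt p pre C ∧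
        Trade θ Q {x | x ∈ C} s s' := by
  cases h with
  | noComponent p i pre C start cycle none pick switch =>
    obtain ⟨h1, h2, h3⟩ := pick.spec cycle hinv.closed start.1
    exact .inl ⟨i, h1, h2, h3, switch⟩
  | trade p pre C T marks path start cycle component marking empty eq settle repoint keep =>
    subst eq
    exact .inr ⟨p, pre, C, start.1, cycle, settle, repoint, keep⟩
  | offCycle p i pre C T marks path start cycle component marking empty ne pick switch =>
    obtain ⟨h1, h2, h3⟩ := pick.spec component.1 marking
    exact .inl ⟨i, h1, h2, h3, switch⟩
  | switchOff p i pre C T marks path start cycle component marking pick switch =>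
    obtain ⟨h2, h3⟩ := marking.of_mem_switchSet component.1.2.2.2 pick.1.1
    exact .inl ⟨i, component.1.2.1 pick.1.1.1, h2, h3, switch⟩
  | switchOn p i pre C T marks path start cycle component marking ne sub pick switch =>
    obtain ⟨h2, h3⟩ := marking.of_mem_switchSet component.1.2.2.2 pick.mem
    exact .inl ⟨i, component.1.2.1 pick.mem.1, h2, h3, switch⟩

/-- Her own item is always a candidate: by rationality, an agent who does not point to herself
points to something strictly better than it. -/
theorem Invariant.exists_isNext [Finite N] {s : State N} (hinv : Invariant θ Q s) {i : N}
    {U : Set N} (hiU : i ∈ U) (hi : i ∈ Q \ s.settled) (hne : s.pt i ≠ i) :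
    ∃ k, IsNext θ i U (s.pt i) k := by
  refine exists_isFavorite θ i ⟨i, hiU, ?_⟩
  rcases (θ i).total (s.pt i) i with h | h | h
  · exact h
  · exact absurd h hne
  · exact absurd h (hinv.rational i hi)

theorem Invariant.exists_switch [Finite N] {s : State N} (hinv : Invariant θ Q s) {i : N}
    (hi : i ∈ Q \ s.settled) (hne : s.pt i ≠ i) :
    ∃ s', Switch θ (Q \ s.settled) i s s' := by
  classical
  obtain ⟨k, hk⟩ := hinv.exists_isNext hi hi hne
  exact ⟨⟨s.settled, Function.update s.pt i k⟩, rfl, by simpa using hk,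
    fun j hj => by simp [hj]⟩

theorem Invariant.exists_trade [Finite N] {s : State N} (hinv : Invariant θ Q s) (T : Set N) :
    ∃ s', Trade θ Q T s s' := by
  classical
  let V := s.settled ∪ T
  have h : ∀ i, ∃ k, (i ∈ Q \ V ∧ s.pt i ∈ V → IsNext θ i (Q \ V) (s.pt i) k) ∧
      (¬ (i ∈ Q \ V ∧ s.pt i ∈ V) → k = s.pt i) := by
    intro i
    by_cases hi : i ∈ Q \ V ∧ s.pt i ∈ V
    · obtain ⟨k, hk⟩ := hinv.exists_isNext (i := i) (U := Q \ V) hi.1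
        ⟨hi.1.1, fun h => hi.1.2 (.inl h)⟩ (fun heq => hi.1.2 (heq ▸ hi.2))
      exact ⟨k, fun _ => hk, fun h => absurd hi h⟩
    · exact ⟨s.pt i, fun h => absurd h hi, fun _ => rfl⟩
  choose f hf hf' using h
  exact ⟨⟨V, f⟩, rfl, fun i hi h => hf i ⟨hi, h⟩, hf'⟩

theorem Invariant.exists_step [Fintype N] {s : State N} (hinv : Invariant θ Q s)
    (hne : s.settled ≠ Q) : ∃ s', Step θ Q ord s s' := by
  have hU : (Q \ s.settled).Nonempty :=
    Set.sdiff_nonempty.2 fun h => hne (hinv.sub.antisymm h)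
  obtain ⟨p, hp⟩ := exists_isFirst ord hU
  obtain ⟨pre, C, horb⟩ := exists_isOrbit s.pt p
  by_cases hcomp : ∃ T, IsComponentFor θ (Q \ s.settled) s.pt C T
  swap
  · push Not at hcomp
    obtain ⟨i, hi⟩ := exists_noComponentPick horb hinv.closed hp.1 hcomp
    obtain ⟨h1, h2, -⟩ := hi.spec horb hinv.closed hp.1
    obtain ⟨s', hs'⟩ := hinv.exists_switch h1 h2
    exact ⟨s', .noComponent s s' p i pre C hp horb hcomp hi hs'⟩
  obtain ⟨T, hTc, hTmin⟩ := Set.exists_min_image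
    {T | IsComponentFor θ (Q \ s.settled) s.pt C T} Set.ncard (Set.toFinite _) hcomp
  have hT : IsMinComponentFor θ (Q \ s.settled) s.pt C T := ⟨hTc, hTmin⟩
  obtain ⟨marks, path, hm⟩ := exists_isMarking ord hTc.2.2.2 hTc.2.2.1
  by_cases hoff : (switchSet θ s.pt T marks \ {x | x ∈ C}).Nonempty
  · obtain ⟨i, hi⟩ := exists_isFirst ord hoff
    obtain ⟨s', hs'⟩ := hinv.exists_switch (hTc.2.1 hi.1.1.1)
      (hm.of_mem_switchSet hTc.2.2.2 hi.1.1).1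
    exact ⟨s', .switchOff s s' p i pre C T marks path hp horb hT hm hi hs'⟩
  have hsub : switchSet θ s.pt T marks ⊆ {x | x ∈ C} := by
    rwa [Set.sdiff_nonempty, not_not] at hoff
  rcases (switchSet θ s.pt T marks).eq_empty_or_nonempty with hE | hE
  swap
  · have : ∃ i, OnCyclePick ord s.pt T (switchSet θ s.pt T marks) path i := by
      rcases {x | x ∈ switchSet θ s.pt T marks ∧
        Covers s.pt T path x}.eq_empty_or_nonempty with hcov | hcov
      · obtain ⟨i, hi⟩ := exists_isFirst ord hE
        exact ⟨i, .inr ⟨fun x hx hc => Set.eq_empty_iff_forall_notMem.1 hcov x ⟨hx, hc⟩, hi⟩⟩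
      · obtain ⟨i, hi⟩ := exists_isFirst ord hcov
        exact ⟨i, .inl hi⟩
    obtain ⟨i, hi⟩ := this
    obtain ⟨s', hs'⟩ := hinv.exists_switch (hTc.2.1 hi.mem.1)
      (hm.of_mem_switchSet hTc.2.2.2 hi.mem).1
    exact ⟨s', .switchOn s s' p i pre C T marks path hp horb hT hm hE hsub hi hs'⟩
  by_cases hCT : {x | x ∈ C} = T
  · obtain ⟨s', h1, h2, h3⟩ := hinv.exists_trade T
    exact ⟨s', .trade s s' p pre C T marks path hp horb hT hm hE hCT h1 h2 h3⟩
  · obtain ⟨i, hi⟩ := exists_offCyclePick horb hT hCT hm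
    obtain ⟨h1, h2, -⟩ := hi.spec hTc hm
    obtain ⟨s', hs'⟩ := hinv.exists_switch h1 h2
    exact ⟨s', .offCycle s s' p i pre C T marks path hp horb hT hm hE hCT hi hs'⟩

/-- The only item newly passed over is the one dropped, which is neither her own nor a neighbour's.
-/
theorem Invariant.switch {s s' : State N} (hinv : Invariant θ Q s) {i : N}
    (hi : i ∈ Q \ s.settled) (hne : s.pt i ≠ i) (hed : ¬ Edge θ i (s.pt i))
    (hsw : Switch θ (Q \ s.settled) i s s') : Invariant θ Q s' := by
  obtain ⟨hset, hnext, hkeep⟩ := hsw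
  have hstay : ∀ j ∈ s.settled, s'.pt j = s.pt j := fun j hj =>
    hkeep j fun h => hi.2 (h ▸ hj)
  have hworse : ∀ k ∈ Q \ s.settled, k ≠ s.pt i → ¬ (θ i).prefers k (s.pt i) →
      ¬ (θ i).prefers k (s'.pt i) := by
    intro k hk hne' hnp
    refine hnext.not_prefers ⟨hk, ?_⟩
    rcases (θ i).total (s.pt i) k with h | h | h
    · exact h
    · exact absurd h.symm hne'
    · exact absurd h hnp
  constructor
  · rw [hset]; exact hinv.sub
  · rw [hset]
    intro j hj
    by_cases hji : j = i
    · subst hji; exact hnext.1.1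
    · rw [hkeep j hji]; exact hinv.closed j hj
  · rw [hset]
    intro j hj
    by_cases hji : j = i
    · subst hji; exact hworse j hj hne.symm (hinv.rational j hj)
    · rw [hkeep j hji]; exact hinv.rational j hj
  · rw [hset]
    intro j hj k hk he
    by_cases hji : j = i
    · subst hji
      exact hworse k hk (fun h => hed (h ▸ he)) (hinv.nbrs j hj k hk he)
    · rw [hkeep j hji]; exact hinv.nbrs j hj k hk he
  · rw [hset]
    intro j hj
    rw [hstay j hj]
    exact hinv.mapsTo j hj
  · rw [hset]
    exact hinv.injOn.congr fun j hj => (hstay j hj).symm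
  · intro j hj
    rw [hkeep j fun h => hj (h ▸ hi.1)]
    exact hinv.outside j hj
  · obtain ⟨t, ht⟩ := hinv.times
    refine ⟨t, ?_⟩
    rw [hset]
    intro j hj
    rw [hstay j hj]
    exact ht j hj

/-- Repointing agents give up settled items only, so comparisons with items still present survive.
The traders prefer no unsettled item of their own or of a neighbour, so whatever they envy among
these is already settled. -/
theorem Invariant.trade [Fintype N] {s s' : State N} (hinv : Invariant θ Q s) {T : Set N}
    (hTU : T ⊆ Q \ s.settled) (hmaps : ∀ i ∈ T, s.pt i ∈ T) (hinj : Set.InjOn s.pt T)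
    (htr : Trade θ Q T s s') : Invariant θ Q s' := by
  classical
  obtain ⟨hset, hre, hkeep⟩ := htr
  have hU : Q \ s'.settled ⊆ Q \ s.settled := by
    rw [hset]
    exact fun x hx => ⟨hx.1, fun h => hx.2 (.inl h)⟩
  have hstay : ∀ j ∈ s'.settled, s'.pt j = s.pt j := fun j hj => hkeep j fun h => h.1.2 hj
  have hworse : ∀ i ∈ Q \ s'.settled, ∀ k ∈ Q \ s'.settled, ¬ (θ i).prefers k (s.pt i) →
      ¬ (θ i).prefers k (s'.pt i) := by
    intro i hi k hk hnp
    by_cases hp : s.pt i ∈ s'.settled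
    · refine (hre i hi hp).not_prefers ⟨hk, ?_⟩
      rcases (θ i).total (s.pt i) k with h | h | h
      · exact h
      · exact absurd (h ▸ hp) hk.2
      · exact absurd h hnp
    · rwa [hkeep i fun h => hp h.2]
  constructor
  · rw [hset]
    exact Set.union_subset hinv.sub fun x hx => (hTU hx).1
  · intro i hi
    by_cases hp : s.pt i ∈ s'.settled
    · exact (hre i hi hp).1.1
    · rw [hkeep i fun h => hp h.2]
      exact ⟨(hinv.closed i (hU hi)).1, hp⟩
  · exact fun i hi => hworse i hi i hi (hinv.rational i (hU hi))
  · exact fun i hi k hk he => hworse i hi k hk (hinv.nbrs i (hU hi) k (hU hk) he)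
  · intro i hi
    rw [hstay i hi]
    rw [hset] at hi ⊢
    exact hi.imp (hinv.mapsTo i) (hmaps i)
  · refine Set.InjOn.congr (f₁ := s.pt) ?_ fun j hj => (hstay j hj).symm
    rw [hset, Set.injOn_union (Set.disjoint_right.2 fun x hx => (hTU hx).2)]
    refine ⟨hinv.injOn, hinj, fun x hx y hy heq => ?_⟩
    exact (hTU (hmaps y hy)).2 (heq ▸ hinv.mapsTo x hx)
  · intro i hi
    rw [hkeep i fun h => hi h.1.1]
    exact hinv.outside i hi
  · obtain ⟨t, ht⟩ := hinv.times
    -- Only the order of times matters: the new value just has to exceed every old one.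
    refine ⟨fun x => if x ∈ T then (∑ y, t y) + 1 else t x, fun i hi => ?_⟩
    rw [hstay i hi]
    rw [hset] at hi ⊢
    have hdisj : ∀ x ∈ s.settled, x ∉ T := fun x hx hxT => (hTU hxT).2 hx
    rcases hi with hi | hi
    · have hpi := hinv.mapsTo i hi
      obtain ⟨h1, h2⟩ := ht i hi
      refine ⟨by simp [hdisj _ hi, hdisj _ hpi, h1], fun k hk he hpr => ?_⟩
      obtain ⟨h3, h4⟩ := h2 k hk he hpr
      exact ⟨.inl h3, by simpa [hdisj _ hi, hdisj _ h3] using h4⟩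
    · refine ⟨by simp [hi, hmaps i hi], fun k hk he hpr => ?_⟩
      have hks : k ∈ s.settled := by
        by_contra hks
        rcases he with he | rfl
        · exact hinv.nbrs i (hTU hi) k ⟨hk, hks⟩ he hpr
        · exact hinv.rational k (hTU hi) hpr
      refine ⟨.inl hks, ?_⟩
      simp only [hdisj _ hks, hi, if_true, if_false]
      exact Nat.lt_succ_of_le (Finset.single_le_sum (fun _ _ => Nat.zero_le _)
        (Finset.mem_univ k))

theorem Invariant.cycle_subset {s : State N} (hinv : Invariant θ Q s) {p : N} {pre C : List N}
    (hp : p ∈ Q \ s.settled) (horb : IsOrbit s.pt p pre C) :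
    {x | x ∈ C} ⊆ Q \ s.settled :=
  fun x hx => horb.mem_of_closed hinv.closed hp x (List.mem_append.2 (.inr hx))

theorem Invariant.step [Fintype N] {s s' : State N} (hinv : Invariant θ Q s)
    (h : Step θ Q ord s s') : Invariant θ Q s' := by
  rcases h.cases hinv with ⟨i, hi, hne, hed, hsw⟩ | ⟨p, pre, C, hp, horb, htr⟩
  · exact hinv.switch hi hne hed hsw
  · exact hinv.trade (hinv.cycle_subset hp horb) (fun i hi => horb.map_mem hi) horb.injOn htr

theorem Invariant.of_reach [Fintype N] {s s' : State N} (hinv : Invariant θ Q s)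
    (h : Relation.ReflTransGen (Step θ Q ord) s s') : Invariant θ Q s' := by
  induction h with
  | refl => exact hinv
  | tail _ hstep ih => exact ih.step hstep

/-- The number of items that an agent likes less than the one she points to, summed over the
agents, plus the number of agents still present. -/
noncomputable def potential [Fintype N] (θ : Profile N) (Q : Set N) (s : State N) : ℕ :=
  ∑ i, {x | (θ i).prefers (s.pt i) x}.ncard + (Q \ s.settled).ncard

theorem IsNext.ncard_lt [Finite N] {i j k : N} {A : Set N} (h : IsNext θ i A j k) :
    {x | (θ i).prefers k x}.ncard < {x | (θ i).prefers j x}.ncard := by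
  refine Set.ncard_lt_ncard ⟨fun x hx => (θ i).trans h.1.2 hx, fun hs => ?_⟩ (Set.toFinite _)
  exact (θ i).irrefl k (hs h.1.2)

/-- A switch moves one agent strictly down her preferences; a trade moves nobody up and removes a
non-empty cycle. -/
theorem Step.potential_lt [Fintype N] {s s' : State N} (hinv : Invariant θ Q s)
    (h : Step θ Q ord s s') : potential θ Q s' < potential θ Q s := by
  rcases h.cases hinv with ⟨i, hi, hne, hed, hset, hnext, hkeep⟩ |
    ⟨p, pre, C, hp, horb, hset, hre, hkeep⟩
  · unfold potential
    rw [hset]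
    refine Nat.add_lt_add_right (Finset.sum_lt_sum (fun j _ => ?_)
      ⟨i, Finset.mem_univ _, hnext.ncard_lt⟩) _
    by_cases hji : j = i
    · subst hji; exact hnext.ncard_lt.le
    · rw [hkeep j hji]
  · refine Nat.add_lt_add_of_le_of_lt (Finset.sum_le_sum fun j _ => ?_) ?_
    · by_cases hj : j ∈ Q \ s'.settled ∧ s.pt j ∈ s'.settled
      · exact (hre j hj.1 hj.2).ncard_lt.le
      · rw [hkeep j hj]
    · obtain ⟨c, hc⟩ := horb.nonempty
      have hcU := hinv.cycle_subset hp horb hc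
      rw [hset]
      refine Set.ncard_lt_ncard ⟨fun x hx => ⟨hx.1, fun h => hx.2 (.inl h)⟩, fun hs => ?_⟩
        (Set.toFinite _)
      exact (hs hcU).2 (.inr hc)

theorem Invariant.exists_execution [Fintype N] (ord : N ≃ Fin n) :
    ∀ (m : ℕ) (s : State N), potential θ Q s = m → Invariant θ Q s →
      ∃ s', Relation.ReflTransGen (Step θ Q ord) s s' ∧ s'.settled = Q := by
  intro m
  induction m using Nat.strong_induction_on with
  | _ m ih =>
  intro s hm hinv
  by_cases hQ : s.settled = Q
  · exact ⟨s, .refl, hQ⟩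
  obtain ⟨s₁, h₁⟩ := hinv.exists_step (ord := ord) hQ
  obtain ⟨s', hs', hQ'⟩ := ih _ (hm ▸ h₁.potential_lt hinv) s₁ rfl (hinv.step h₁)
  exact ⟨s', .head h₁ hs', hQ'⟩

/-- Qualified agents point injectively among themselves and all others to themselves, so the two
parts cannot collide. -/
theorem Invariant.bijective [Finite N] {s : State N} (hinv : Invariant θ Q s)
    (hQ : s.settled = Q) : Function.Bijective s.pt := by
  refine Finite.injective_iff_bijective.1 fun a b hab => ?_
  by_cases ha : a ∈ Q <;> by_cases hb : b ∈ Q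
  · exact hinv.injOn (hQ ▸ ha) (hQ ▸ hb) hab
  · rw [hinv.outside b hb] at hab
    exact absurd (hab ▸ hQ ▸ hinv.mapsTo a (hQ ▸ ha)) hb
  · rw [hinv.outside a ha] at hab
    exact absurd (hab ▸ hQ ▸ hinv.mapsTo b (hQ ▸ hb)) ha
  · rwa [hinv.outside a ha, hinv.outside b hb] at hab

theorem exists_isInit [Finite N] (N₀ : Set N) (θ : Profile N) : ∃ s, IsInit N₀ θ s := by
  have h : ∀ i, ∃ k, (i ∈ qualified N₀ θ → IsFavorite θ i (qualified N₀ θ) k) ∧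
      (i ∉ qualified N₀ θ → k = i) := by
    intro i
    by_cases hi : i ∈ qualified N₀ θ
    · obtain ⟨k, hk⟩ := exists_isFavorite θ i ⟨i, hi⟩
      exact ⟨k, fun _ => hk, fun h => absurd hi h⟩
    · exact ⟨i, fun h => absurd h hi, fun _ => rfl⟩
  choose f hf hf' using h
  exact ⟨⟨∅, f⟩, rfl, hf, hf'⟩

end Rounds

/-! ### Well-definedness and stability. -/

theorem exists_isCTC {N : Type*} [Fintype N] (N₀ : Set N)
    (O : Profile N → (N ≃ Fin (Fintype.card N))) : ∃ π : Mechanism N, IsCTC N₀ O π := by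
  have h : ∀ θ : Profile N, ∃ σ : Equiv.Perm N, ∃ s₀ s, IsInit N₀ θ s₀ ∧
      Relation.ReflTransGen (Step θ (qualified N₀ θ) (O θ)) s₀ s ∧
      s.settled = qualified N₀ θ ∧ ∀ i, σ i = s.pt i := by
    intro θ
    obtain ⟨s₀, h₀⟩ := exists_isInit N₀ θ
    obtain ⟨s, hs, hQ⟩ := Invariant.exists_execution (O θ) _ s₀ rfl h₀.invariant
    exact ⟨.ofBijective s.pt ((h₀.invariant.of_reach hs).bijective hQ), s₀, s, h₀, hs, hQ,
      fun _ => rfl⟩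
  choose π hπ using h
  exact ⟨π, hπ⟩

theorem IsCTC.stableCC {N : Type*} [Fintype N] {N₀ : Set N}
    {O : Profile N → (N ≃ Fin (Fintype.card N))} {π : Mechanism N} (h : IsCTC N₀ O π) :
    StableCC N₀ π := by
  classical
  rintro θ ⟨S, hSQ, ⟨-, hS⟩, π', hmaps, hweak, j, hj, hbetter⟩
  obtain ⟨s₀, s, h₀, hs, hQ, hπ⟩ := h θ
  have hinv := h₀.invariant.of_reach hs
  obtain ⟨t, ht⟩ := hinv.times
  -- Completeness enters here: `π' i` is either `i` or one of her neighbours, so the envied item was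
  -- settled earlier.
  have hlt : ∀ i ∈ S, (θ i).prefers (π' i) (π θ i) → t (π' i) < t i := by
    intro i hi hp
    rw [hπ] at hp
    refine ((ht i (hQ ▸ hSQ hi)).2 _ (hSQ (hmaps i hi)) ?_ hp).2
    by_cases hne : π' i = i
    · exact .inr hne
    · exact .inl (hS i hi _ (hmaps i hi) (Ne.symm hne))
  have hle : ∀ i ∈ S, t (π' i) ≤ t i := by
    intro i hi
    rcases hweak i hi with heq | hp
    · rw [heq, hπ]
      exact (ht i (hQ ▸ hSQ hi)).1.le
    · exact (hlt i hi hp).le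
  have himage : S.toFinset.image π' = S.toFinset := by
    refine Finset.eq_of_subset_of_card_le (fun x hx => ?_) ?_
    · obtain ⟨i, hi, rfl⟩ := Finset.mem_image.1 hx
      exact Set.mem_toFinset.2 (hmaps i (Set.mem_toFinset.1 hi))
    · rw [Finset.card_image_of_injective _ π'.injective]
  -- Reindexing along `π'`, which permutes `S`, leaves the total time unchanged; the gain of `j`
  -- would make it strictly smaller.
  have hsum : ∑ i ∈ S.toFinset, t (π' i) = ∑ i ∈ S.toFinset, t i := by
    conv_rhs => rw [← himage, Finset.sum_image fun a _ b _ hab => π'.injective hab]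
  refine hsum.not_lt (Finset.sum_lt_sum (fun i hi => hle i (Set.mem_toFinset.1 hi))
    ⟨j, Set.mem_toFinset.2 hj, hlt j hj hbetter⟩)

end HousingNetwork

theorem theoremB9 {N : Type*} [Fintype N] (N₀ : Set N)
    (O : HousingNetwork.Profile N → (N ≃ Fin (Fintype.card N)))
    (hO : HousingNetwork.IsOrdering N₀ O) :
    (∃ π : HousingNetwork.Mechanism N, HousingNetwork.IsCTC N₀ O π) ∧
      ∀ π : HousingNetwork.Mechanism N, HousingNetwork.IsCTC N₀ O π →
        HousingNetwork.StableCC N₀ π :=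
  ⟨HousingNetwork.exists_isCTC N₀ O, fun _ h => h.stableCC⟩
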